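/- Let $\mathbf{k}$ be a field and $\lambda\in\mathbf{k}$. For a set $X$ let $\mathfrak{M}(X)$ be the free operated monoid on $X$ (the monoid of bracketed words on $X$, with operator $u\mapsto\lfloor u\rfloor$), and let $\mathbf{k}\mathfrak{M}(X)$ be the free operated (associative, unitary) $\mathbf{k}$-algebra on $X$. Let $x_1\neq x_2$ be elements of a set $X$. Then the modified Rota–Baxter operated polynomial identity of weight $\lambda$, $$\phi(x_1,x_2)=\lfloor x_1\rfloor\lfloor x_2\rfloor-\lfloor x_1\lfloor x_2\rfloor\rfloor-\lfloor\lfloor x_1\rfloor x_2\rfloor-\lambda x_1x_2\ \in\ \mathbf{k}\mathfrak{M}(X),$$ is Gröbner–Shirshov. That is, for every set $Z$ there is a monomial order $\leq$ on $\mathfrak{M}(Z)$ with respect to which the substitution set $$S_\phi(Z)=\{\phi(u_1,u_2)\mid u_1,u_2\in\mathfrak{M}(Z)\}$$ is a Gröbner–Shirshov basis in $\mathbf{k}\mathfrak{M}(Z)$. Here $\mathfrak{M}^\star(Z)$ is the set of bracketed words on $Z\cup\{\star\}$ in which $\star$ occurs exactly once; for $q\in\mathfrak{M}^\star(Z)$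 and $u\in\mathfrak{M}(Z)$, $q|_u$ is the result of replacing $\star$ by $u$, extended linearly to $q|_s$ for $s\in\mathbf{k}\mathfrak{M}(Z)$. A monomial order is a well-order on $\mathfrak{M}(Z)$ such that $u<v$ implies $q|_u<q|_v$ for all $q\in\mathfrak{M}^\star(Z)$. The leading monomial $\bar f$ of $f\ne 0$ is the largest monomial that appears in $f$, and $\bar 0=1$; $f\neq 0$ is monic if $\bar f$ has coefficient $1$ in $f$. The breadth $|w|$ of $w\in\mathfrak{M}(Z)$ is the number of its factors in $Z\cup\lfloor\mathfrak{M}(Z)\rfloor$. An element is trivial modulo $(S,w)$ if it is a finite sum $\sum_i c_i\,q_i|_{s_i}$ with $c_i\in\mathbf{k}$, $q_i\in\mathfrak{M}^\star(Z)$, $s_i\in S$ and $q_i|_{\overline{s_i}}<w$. A set $S\subseteq\mathbf{k}\mathfrak{M}(Z)$ is a Gröbner–Shirshov basis if for all nonzero elements of $S$, divided by their leading coefficients to give monic $f,g$: 1. whenever $w=\bar f u=v\bar g$ with $u,v,w\in\mathfrak{M}(Z)$ and $\max\{|\bar f|,|\bar g|\}<|w|<|\bar f|+|\bar g|$, the element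 $fu-vg$ is trivial modulo $(S,w)$; 2. whenever $w=\bar f=q|_{\bar g}$ with $q\in\mathfrak{M}^\star(Z)$, the element $f-q|_g$ is trivial modulo $(S,w)$. -/

import Mathlib

universe w u v

/-- Bracketed words on `X`, i.e. the elements of the free operated monoid `𝔐(X)`.  A bracketed word
is a finite product of letters `x ∈ X` and brackets `⌊u⌋` of bracketed words `u`; here it is
presented by its leftmost factor: `one` is the empty word, `consLetter x w` is `x · w`, and
`consBracket u w` is `⌊u⌋ · w`. -/
inductive BracketedWord (X : Type*) where
  | one : BracketedWord X
  | consLetter (x : X) (w : BracketedWord X) : BracketedWord X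
  | consBracket (u : BracketedWord X) (w : BracketedWord X) : BracketedWord X

namespace BracketedWord

/-- Concatenation of bracketed words. -/
def append {X : Type*} : BracketedWord X → BracketedWord X → BracketedWord X
  | one, v => v
  | consLetter x w, v => consLetter x (append w v)
  | consBracket u w, v => consBracket u (append w v)

instance instMonoid {X : Type*} : Monoid (BracketedWord X) where
  one := one
  mul := append
  one_mul _ := rfl
  mul_one u := by
    change append u one = u
    induction u with
    | one => rfl
    | consLetter x w ih => simp only [append, ih]
    | consBracket u w _ ih => simp only [append, ih]
  mul_assoc u v w := by
    change append (append u v) w = append u (append v w)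
    induction u with
    | one => rfl
    | consLetter x t ih => simp only [append, ih]
    | consBracket s t _ ih => simp only [append, ih]

/-- A letter as a bracketed word. -/
def letter {X : Type*} (x : X) : BracketedWord X := consLetter x one

/-- The operator `u ↦ ⌊u⌋` on bracketed words. -/
def bracket {X : Type*} (u : BracketedWord X) : BracketedWord X := consBracket u one

/-- The breadth `|w|`: the number of factors of `w` that are letters or brackets. -/
def breadth {X : Type*} : BracketedWord X → ℕ
  | one => 0
  | consLetter _ w => breadth w + 1
  | consBracket _ w => breadth w + 1

/-- The underlying function of `BracketedWord.lift`. -/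
def liftFun {X M : Type*} [Monoid M] (P : M → M) (θ : X → M) : BracketedWord X → M
  | one => 1
  | consLetter x w => θ x * liftFun P θ w
  | consBracket u w => P (liftFun P θ u) * liftFun P θ w

/-- The morphism of operated monoids from `𝔐(X)` to the operated monoid `(M, P)` that
extends the map `θ : X → M`. -/
def lift {X M : Type*} [Monoid M] (P : M → M) (θ : X → M) : BracketedWord X →* M where
  toFun := liftFun P θ
  map_one' := rfl
  map_mul' u v := by
    change liftFun P θ (append u v) = liftFun P θ u * liftFun P θ v
    induction u with
    | one => simp only [append, liftFun, one_mul]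
    | consLetter x w ih => simp only [append, liftFun, ih, mul_assoc]
    | consBracket u w _ ih => simp only [append, liftFun, ih, mul_assoc]

/-- The number of occurrences of the symbol `⋆` (represented by `none`), at all bracket depths,
in a bracketed word on `Z ∪ {⋆}`. -/
def starCount {Z : Type*} : BracketedWord (Option Z) → ℕ
  | one => 0
  | consLetter none w => starCount w + 1
  | consLetter (some _) w => starCount w
  | consBracket u w => starCount u + starCount w

end BracketedWord

/-- The free operated algebra `k𝔐(X)`, as an algebra; its operator is `OperatedPoly.op`. -/
abbrev OperatedPoly (k X : Type*) [Field k] : Type _ := MonoidAlgebra k (BracketedWord X)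

/-- The set `𝔐^⋆(Z)` of `⋆`-bracketed words: bracketed words on `Z ∪ {⋆}` with exactly one
occurrence of `⋆`. -/
def StarWord (Z : Type*) : Type _ := {q : BracketedWord (Option Z) // q.starCount = 1}

namespace StarWord

/-- `q|_u`: the bracketed word on `Z` obtained from `q` by replacing `⋆` by `u`. -/
def subst {Z : Type*} (q : StarWord Z) (u : BracketedWord Z) : BracketedWord Z :=
  BracketedWord.lift BracketedWord.bracket
    (fun o : Option Z => o.elim u BracketedWord.letter) q.1

/-- `q|_s = ∑ cᵢ q|_{uᵢ}` for `s = ∑ cᵢ uᵢ`. -/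
noncomputable def substPoly {k Z : Type*} [Field k] (q : StarWord Z) (s : OperatedPoly k Z) :
    OperatedPoly k Z :=
  MonoidAlgebra.mapDomain q.subst s

end StarWord

namespace OperatedPoly

/-- A bracketed word as a monomial of `k𝔐(X)`. -/
noncomputable def mono (k : Type*) [Field k] {X : Type*} (u : BracketedWord X) :
    OperatedPoly k X :=
  MonoidAlgebra.of k (BracketedWord X) u

/-- A variable `x ∈ X` as an element of `k𝔐(X)`. -/
noncomputable def var (k : Type*) [Field k] {X : Type*} (x : X) : OperatedPoly k X :=
  mono k (BracketedWord.letter x)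

/-- The linear operator `⌊ ⌋` on `k𝔐(X)`, the linear extension of `u ↦ ⌊u⌋`. -/
noncomputable def op (k X : Type*) [Field k] : OperatedPoly k X →ₗ[k] OperatedPoly k X :=
  MonoidAlgebra.mapDomainLinearMap k k BracketedWord.bracket

/-- Evaluation `φ(r)` of an operated polynomial at a point `r : X → R` of an operated algebra
`(R, P)`: the morphism of operated algebras `k𝔐(X) → R` that extends `r`. -/
noncomputable def eval {k X R : Type*} [Field k] [Ring R] [Algebra k R] (P : R →ₗ[k] R)
    (r : X → R) : OperatedPoly k X →ₐ[k] R :=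
  MonoidAlgebra.lift k R (BracketedWord X) (BracketedWord.lift P r)

/-- The substitution set `S_Φ(Z) = {φ(u) | φ ∈ Φ, u : X → 𝔐(Z)}` in `k𝔐(Z)` of a system `Φ` of
operated polynomial identities. -/
def substitutionSet {k X : Type*} [Field k] (Φ : Set (OperatedPoly k X)) (Z : Type*) :
    Set (OperatedPoly k Z) :=
  {f | ∃ φ ∈ Φ, ∃ u : X → BracketedWord Z, f = eval (op k Z) (fun x => mono k (u x)) φ}

/-- A monomial order on `𝔐(Z)`: a well-order that is compatible with all `⋆`-bracketed words. -/
structure IsMonomialOrder (Z : Type*) [LinearOrder (BracketedWord Z)] : Prop where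
  wellFounded : WellFounded (fun u v : BracketedWord Z => u < v)
  subst_lt_subst : ∀ (q : StarWord Z) (u v : BracketedWord Z), u < v → q.subst u < q.subst v

section Leading

variable {k Z : Type*} [Field k] [LinearOrder (BracketedWord Z)]

open Classical in
/-- The leading monomial of `f`: the largest monomial that appears in `f`, and `1` for `f = 0`.
(For a nonzero scalar this is `1` too, the only monomial that appears.) -/
noncomputable def leadMonomial (f : OperatedPoly k Z) : BracketedWord Z :=
  if h : f.coeff.support.Nonempty then f.coeff.support.max' h else 1

/-- The coefficient of the leading monomial. -/
noncomputable def leadCoeff (f : OperatedPoly k Z) : k := f.coeff (leadMonomial f)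

/-- `f` divided by its leading coefficient. -/
noncomputable def monicize (f : OperatedPoly k Z) : OperatedPoly k Z := (leadCoeff f)⁻¹ • f

/-- `f` is trivial modulo `(S, w)`: it is a finite sum `∑ cᵢ qᵢ|_{sᵢ}` with `cᵢ ∈ k`, `sᵢ ∈ S` and
`qᵢ|_{s̄ᵢ} < w`. -/
def IsTrivialMod (S : Set (OperatedPoly k Z)) (w : BracketedWord Z) (f : OperatedPoly k Z) :
    Prop :=
  f ∈ Submodule.span k
    {g | ∃ (q : StarWord Z) (s : OperatedPoly k Z),
      s ∈ S ∧ q.subst (leadMonomial s) < w ∧ g = q.substPoly s}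

/-- Every intersection composition `f u - v g` of `f` and `g`, with respect to a word
`w = f̄ u = v ḡ` with `max (|f̄|, |ḡ|) < |w| < |f̄| + |ḡ|`, is trivial modulo `(S, w)`. -/
def IntersectionCompositionsTrivial (S : Set (OperatedPoly k Z)) (f g : OperatedPoly k Z) : Prop :=
  ∀ w u v : BracketedWord Z,
    w = leadMonomial f * u → w = v * leadMonomial g →
    max (leadMonomial f).breadth (leadMonomial g).breadth < w.breadth →
    w.breadth < (leadMonomial f).breadth + (leadMonomial g).breadth →
    IsTrivialMod S w (f * mono k u - mono k v * g)

/-- Every including composition `f - q|_g` of `f` and `g`, with respect to a word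
`w = f̄ = q|_ḡ`, is trivial modulo `(S, w)`. -/
def IncludingCompositionsTrivial (S : Set (OperatedPoly k Z)) (f g : OperatedPoly k Z) : Prop :=
  ∀ (w : BracketedWord Z) (q : StarWord Z),
    w = leadMonomial f → w = q.subst (leadMonomial g) →
    IsTrivialMod S w (f - q.substPoly g)

/-- `S` is a Gröbner–Shirshov basis in `k𝔐(Z)` with respect to the given order: all compositions
of (the monicizations of) its elements are trivial.  The zero polynomial cannot be made monic and
takes no part in compositions. -/
def IsGroebnerShirshovBasis (S : Set (OperatedPoly k Z)) : Prop :=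
  ∀ f ∈ S, ∀ g ∈ S, f ≠ 0 → g ≠ 0 →
    IntersectionCompositionsTrivial S (monicize f) (monicize g) ∧
    IncludingCompositionsTrivial S (monicize f) (monicize g)

end Leading

/-- A system `Φ` of operated polynomial identities is Gröbner–Shirshov if for every set `Z` there
is a monomial order on `𝔐(Z)` with respect to which `S_Φ(Z)` is a Gröbner–Shirshov basis. -/
def IsGroebnerShirshov.{w1, u1, v1} {k : Type u1} {X : Type v1} [Field k]
    (Φ : Set (OperatedPoly k X)) : Prop :=
  ∀ Z : Type w1, ∃ _ : LinearOrder (BracketedWord Z),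
    IsMonomialOrder Z ∧ IsGroebnerShirshovBasis (substitutionSet Φ Z)

/-- The modified Rota–Baxter identity of weight `c` in the variables `x₁, x₂`:
`⌊x₁⌋⌊x₂⌋ - ⌊x₁⌊x₂⌋⌋ - ⌊⌊x₁⌋x₂⌋ - c x₁x₂`. -/
noncomputable def modifiedRotaBaxter {k X : Type*} [Field k] (c : k) (x₁ x₂ : X) :
    OperatedPoly k X :=
  op k X (var k x₁) * op k X (var k x₂)
    - op k X (var k x₁ * op k X (var k x₂))
    - op k X (op k X (var k x₁) * var k x₂)
    - c • (var k x₁ * var k x₂)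

end OperatedPoly

/-! Write a bracketed word as a flat word in letters and two bracket symbols, and order flat words
by length, then lexicographically, with opening bracket < closing bracket < letters and the letters
well-ordered. Substitution for `⋆` only adds a fixed prefix and suffix, so this is a monomial order
(`isMonomialOrder_flatOrder`).

The leading monomial of φ(u,v) is ⌊u⌋⌊v⌋: the two nested monomials have the same length but are
lexicographically smaller, and uv is shorter. Leading coefficients are thus 1, for every weight.

Leading monomials are products of two brackets, so few compositions exist. Intersections occur only
on ⌊u⌋⌊v⌋⌊w⌋, and `modifiedRotaBaxterAt_mul_sub` resolves them; the weight terms cancel. An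
inclusion is either an equality of leading monomials, hence f = g, or takes place inside one of the
two brackets. The latter is resolved because φ is linear in each argument, so that rewriting an
argument commutes with rewriting the whole. It remains to check that every summand has leading
monomial below the ambiguity. -/

namespace BracketedWord

variable {X Z : Type*}

/-! ### Breadth and substitution for `⋆` -/

theorem consLetter_eq (x : X) (w : BracketedWord X) : consLetter x w = letter x * w := rfl

theorem bracket_mul_bracket (u v : BracketedWord X) :
    bracket u * bracket v = consBracket u (consBracket v one) := rfl

theorem breadth_mul (u v : BracketedWord X) : (u * v).breadth = u.breadth + v.breadth := by
  change (append u v).breadth = _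
  induction u with
  | one => simp [append, breadth]
  | consLetter x w ih => simp only [append, breadth, ih]; omega
  | consBracket u w _ ih => simp only [append, breadth, ih]; omega

theorem breadth_bracket (u : BracketedWord X) : (bracket u).breadth = 1 := rfl

theorem breadth_eq_zero {u : BracketedWord X} (h : u.breadth = 0) : u = one := by
  cases u <;> simp_all [breadth]

/-- The embedding of `𝔐(Z)` into the bracketed words on `Z ∪ {⋆}`. -/
def starFree : BracketedWord Z → BracketedWord (Option Z)
  | one => one
  | consLetter x w => consLetter (some x) (starFree w)
  | consBracket u w => consBracket (starFree u) (starFree w)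

theorem starCount_starFree (u : BracketedWord Z) : u.starFree.starCount = 0 := by
  induction u <;> simp_all [starFree, starCount]

theorem starCount_mul (u v : BracketedWord (Option Z)) :
    (u * v).starCount = u.starCount + v.starCount := by
  change (append u v).starCount = _
  induction u with
  | one => simp [append, starCount]
  | consLetter x w ih => cases x <;> simp only [append, starCount, ih]; omega
  | consBracket u w _ ih => simp only [append, starCount, ih]; omega

/-- The replacement of every occurrence of `⋆` by `u`. -/
def plug (u : BracketedWord Z) : BracketedWord (Option Z) →* BracketedWord Z :=
  lift bracket (fun o : Option Z => o.elim u letter)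

theorem plug_one (u : BracketedWord Z) : plug u one = one := rfl

theorem plug_consLetter_none (u : BracketedWord Z) (w : BracketedWord (Option Z)) :
    plug u (consLetter none w) = u * plug u w := rfl

theorem plug_consLetter_some (u : BracketedWord Z) (x : Z) (w : BracketedWord (Option Z)) :
    plug u (consLetter (some x) w) = consLetter x (plug u w) := rfl

theorem plug_consBracket (u : BracketedWord Z) (p w : BracketedWord (Option Z)) :
    plug u (consBracket p w) = consBracket (plug u p) (plug u w) := rfl

theorem plug_starFree (u v : BracketedWord Z) : plug u v.starFree = v := by
  induction v with
  | one => rfl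
  | consLetter x w ih => rw [starFree, plug_consLetter_some, ih]
  | consBracket p w ihp ih => rw [starFree, plug_consBracket, ihp, ih]

theorem plug_eq_of_starCount_eq_zero {q : BracketedWord (Option Z)} (hq : q.starCount = 0)
    (u v : BracketedWord Z) : plug u q = plug v q := by
  induction q with
  | one => rfl
  | consLetter x w ih =>
    cases x with
    | none => simp [starCount] at hq
    | some x => rw [plug_consLetter_some, plug_consLetter_some, ih (by simpa [starCount] using hq)]
  | consBracket p w ihp ih =>
    simp only [starCount, Nat.add_eq_zero_iff] at hq
    rw [plug_consBracket, plug_consBracket, ihp hq.1, ih hq.2]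

theorem eq_one_of_plug_eq_one {t : BracketedWord Z} (ht : t.breadth ≠ 0)
    {q : BracketedWord (Option Z)} (h : plug t q = one) : q = one := by
  rcases q with _ | ⟨_ | x, w⟩ | ⟨p, w⟩
  · rfl
  · rw [plug_consLetter_none] at h
    have := congrArg breadth h
    rw [breadth_mul] at this
    simp only [breadth] at this
    omega
  · simp [plug_consLetter_some] at h
  · simp [plug_consBracket] at h

/-! ### The flat word of a bracketed word and the shortlex order -/

/-- The flat word of a bracketed word. The opening bracket is the least symbol, the closing
bracket is the second, and the letters are above both. -/
def flat : BracketedWord Z → List (WithBot (WithBot Z))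
  | one => []
  | consLetter x w => ((x : WithBot Z) : WithBot (WithBot Z)) :: flat w
  | consBracket u w => ⊥ :: (flat u ++ ((⊥ : WithBot Z) : WithBot (WithBot Z)) :: flat w)

theorem flat_mul (u v : BracketedWord Z) : (u * v).flat = u.flat ++ v.flat := by
  change (append u v).flat = _
  induction u with
  | one => rfl
  | consLetter x w ih => simp only [append, flat, ih, List.cons_append]
  | consBracket u w _ ih => simp only [append, flat, ih, List.cons_append, List.append_assoc]

/-- Flat words are balanced, so the first unmatched closing bracket shows where the word ends. The
arbitrary tails `s`, `t` let the induction pass from inside a bracket to what follows it. -/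
theorem flat_append_closing_injective {u v : BracketedWord Z} {s t : List (WithBot (WithBot Z))}
    (h : u.flat ++ ((⊥ : WithBot Z) : WithBot (WithBot Z)) :: s =
      v.flat ++ ((⊥ : WithBot Z) : WithBot (WithBot Z)) :: t) : u = v ∧ s = t := by
  induction u generalizing v s t with
  | one => cases v <;> simp_all [flat]
  | consLetter x w ih =>
    cases v with
    | one => simp [flat] at h
    | consLetter y w' =>
      simp only [flat, List.cons_append, List.cons.injEq, WithBot.coe_inj] at h
      obtain ⟨rfl, rfl⟩ := ih h.2
      simp [h.1]
    | consBracket _ _ => simp [flat] at h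
  | consBracket p w ihp ih =>
    cases v with
    | one => simp [flat] at h
    | consLetter y w' => simp [flat] at h
    | consBracket p' w' =>
      simp only [flat, List.cons_append, List.cons.injEq, true_and, List.append_assoc] at h
      obtain ⟨rfl, h'⟩ := ihp h
      obtain ⟨rfl, rfl⟩ := ih h'
      simp

theorem flat_injective : Function.Injective (flat : BracketedWord Z → _) := fun u v h =>
  (flat_append_closing_injective (s := []) (t := []) (by rw [h])).1

/-- The part of `q` around its only `⋆` does not depend on the inserted word. This reduces
compatibility with substitution to compatibility with concatenation. -/
theorem exists_flat_plug {q : BracketedWord (Option Z)} (hq : q.starCount = 1) :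
    ∃ l r, ∀ u : BracketedWord Z, (plug u q).flat = l ++ u.flat ++ r := by
  induction q with
  | one => simp [starCount] at hq
  | consLetter x w ih =>
    cases x with
    | none =>
      have hw : w.starCount = 0 := by simpa [starCount] using hq
      refine ⟨[], (plug 1 w).flat, fun u => ?_⟩
      rw [plug_consLetter_none, flat_mul, plug_eq_of_starCount_eq_zero hw u 1, List.nil_append]
    | some x =>
      obtain ⟨l, r, h⟩ := ih (by simpa [starCount] using hq)
      exact ⟨((x : WithBot Z) : WithBot (WithBot Z)) :: l, r, fun u => by
        rw [plug_consLetter_some, flat, h]; rfl⟩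
  | consBracket p w ihp ih =>
    simp only [starCount] at hq
    rcases Nat.eq_zero_or_pos p.starCount with hp | hp
    · obtain ⟨l, r, h⟩ := ih (by omega)
      refine ⟨⊥ :: ((plug 1 p).flat ++ ((⊥ : WithBot Z) : WithBot (WithBot Z)) :: l), r,
        fun u => ?_⟩
      rw [plug_consBracket, flat, h, plug_eq_of_starCount_eq_zero hp u 1]
      simp
    · obtain ⟨l, r, h⟩ := ihp (by omega)
      refine ⟨⊥ :: l, r ++ ((⊥ : WithBot Z) : WithBot (WithBot Z)) :: (plug 1 w).flat,
        fun u => ?_⟩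
      rw [plug_consBracket, flat, h, plug_eq_of_starCount_eq_zero (by omega) u 1]
      simp

/-- The shortlex order of flat words. -/
noncomputable abbrev flatOrder (Z : Type*) [LinearOrder Z] : LinearOrder (BracketedWord Z) :=
  LinearOrder.lift' (fun u => toLex (u.flat.length, u.flat))
    (fun _ _ h => flat_injective (congrArg Prod.snd (toLex.injective h)))

theorem flatOrder_lt_iff [LinearOrder Z] {u v : BracketedWord Z} :
    (flatOrder Z).lt u v ↔ List.Shortlex (· < ·) u.flat v.flat := Iff.rfl

theorem isMonomialOrder_flatOrder [LinearOrder Z] [WellFoundedLT Z] :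
    @OperatedPoly.IsMonomialOrder Z (flatOrder Z) := by
  let := flatOrder Z
  refine ⟨InvImage.wf flat (List.Shortlex.wf wellFounded_lt), fun q u v h => ?_⟩
  obtain ⟨l, r, hq⟩ := exists_flat_plug q.2
  change List.Shortlex _ (plug u q.1).flat (plug v q.1).flat
  replace h : List.Shortlex _ u.flat v.flat := h
  rw [hq, hq]
  clear hq
  rcases List.shortlex_def.1 h with h' | ⟨hl, h'⟩
  · exact List.Shortlex.of_length_lt (by simpa using h')
  · refine List.Shortlex.of_lex (by simp [hl]) ?_
    rw [List.append_assoc, List.append_assoc]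
    refine List.Lex.append_left _ ?_ l
    clear h
    generalize u.flat = a at *
    generalize v.flat = b at *
    -- Appending on the right can reverse a comparison only if one word is a proper prefix of the
    -- other; equal lengths exclude this.
    induction h' with
    | nil => simp at hl
    | cons _ ih => exact .cons (ih (by simpa using hl))
    | rel h => exact .rel h

/-- The left word is `l` delayed by one `⊥`, so the first symbol of `l ++ a :: t` other than `⊥`
faces a `⊥`. -/
theorem lex_bot_cons_append {α : Type*} [PartialOrder α] [OrderBot α] {a : α} (ha : ⊥ < a)
    (l s t : List α) : List.Lex (· < ·) (⊥ :: (l ++ s)) (l ++ a :: t) := by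
  induction l with
  | nil => exact .rel ha
  | cons b l ih =>
    rcases eq_or_ne b ⊥ with rfl | hb
    · exact .cons ih
    · exact .rel (bot_lt_iff_ne_bot.2 hb)

theorem bracket_mul_bracket_right_lt [LinearOrder Z] (u v : BracketedWord Z) :
    (flatOrder Z).lt (bracket (u * bracket v)) (bracket u * bracket v) := by
  rw [flatOrder_lt_iff]
  refine List.Shortlex.of_lex ?_ ?_
  · simp [bracket, flat_mul, flat]
  · simp only [bracket, flat_mul, flat, List.append_assoc, List.cons_append, List.nil_append]
    exact .cons (List.Lex.append_left _ (.rel (WithBot.bot_lt_coe _)) _)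

theorem bracket_bracket_left_mul_lt [LinearOrder Z] (u v : BracketedWord Z) :
    (flatOrder Z).lt (bracket (bracket u * v)) (bracket u * bracket v) := by
  rw [flatOrder_lt_iff]
  refine List.Shortlex.of_lex ?_ ?_
  · simp [bracket, flat_mul, flat]; omega
  · simp only [bracket, flat_mul, flat, List.append_assoc, List.cons_append, List.nil_append]
    exact .cons (lex_bot_cons_append (WithBot.bot_lt_coe _) _ _ _)

theorem mul_lt_bracket_mul_bracket [LinearOrder Z] (u v : BracketedWord Z) :
    (flatOrder Z).lt (u * v) (bracket u * bracket v) := by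
  rw [flatOrder_lt_iff]
  refine List.Shortlex.of_length_lt ?_
  simp [bracket, flat_mul, flat]; omega

end BracketedWord

/-! ### Words with one `⋆` and occurrences in a product of two brackets -/

namespace StarWord

open BracketedWord

variable {k Z : Type*} [Field k]

theorem subst_eq_plug (q : StarWord Z) (u : BracketedWord Z) : q.subst u = plug u q.1 := rfl

/-- The word `⋆`. -/
def star (Z : Type*) : StarWord Z := ⟨letter none, rfl⟩

/-- The word `⌊q⌋`. -/
def bracketed (q : StarWord Z) : StarWord Z := ⟨bracket q.1, by simp [bracket, starCount, q.2]⟩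

/-- The word `u q`. -/
def mulLeft (u : BracketedWord Z) (q : StarWord Z) : StarWord Z :=
  ⟨u.starFree * q.1, by rw [starCount_mul, starCount_starFree, q.2]⟩

/-- The word `q u`. -/
def mulRight (q : StarWord Z) (u : BracketedWord Z) : StarWord Z :=
  ⟨q.1 * u.starFree, by rw [starCount_mul, starCount_starFree, q.2]⟩

@[simp] theorem subst_star (t : BracketedWord Z) : (star Z).subst t = t := mul_one t

@[simp] theorem subst_bracketed (q : StarWord Z) (t : BracketedWord Z) :
    q.bracketed.subst t = bracket (q.subst t) := rfl

@[simp] theorem subst_mulLeft (u : BracketedWord Z) (q : StarWord Z) (t : BracketedWord Z) :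
    (mulLeft u q).subst t = u * q.subst t := by
  rw [subst_eq_plug, mulLeft, map_mul, plug_starFree]; rfl

@[simp] theorem subst_mulRight (q : StarWord Z) (u : BracketedWord Z) (t : BracketedWord Z) :
    (mulRight q u).subst t = q.subst t * u := by
  rw [subst_eq_plug, mulRight, map_mul, plug_starFree]; rfl

@[simp] theorem substPoly_mono (q : StarWord Z) (u : BracketedWord Z) :
    q.substPoly (OperatedPoly.mono k u) = OperatedPoly.mono k (q.subst u) :=
  MonoidAlgebra.mapDomain_single

theorem substPoly_smul (q : StarWord Z) (a : k) (f : OperatedPoly k Z) :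
    q.substPoly (a • f) = a • q.substPoly f :=
  map_smul (MonoidAlgebra.mapDomainLinearMap k k q.subst) a f

theorem substPoly_sub (q : StarWord Z) (f g : OperatedPoly k Z) :
    q.substPoly (f - g) = q.substPoly f - q.substPoly g :=
  map_sub (MonoidAlgebra.mapDomainLinearMap k k q.subst) f g

/-- The occurrences of a word of breadth two in a product of two brackets. -/
theorem subst_eq_bracket_mul_bracket {q : StarWord Z} {t u v : BracketedWord Z}
    (ht : t.breadth = 2) (h : q.subst t = bracket u * bracket v) :
    (∀ s, q.subst s = s) ∨
    (∃ p : StarWord Z, p.subst t = u ∧ ∀ s, q.subst s = bracket (p.subst s) * bracket v) ∨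
    (∃ p : StarWord Z, p.subst t = v ∧ ∀ s, q.subst s = bracket u * bracket (p.subst s)) := by
  have ht0 : t.breadth ≠ 0 := by omega
  have hq : q.1.starCount = 1 := q.2
  simp only [bracket_mul_bracket, subst_eq_plug] at h ⊢
  generalize q.1 = q at *
  rcases q with _ | ⟨_ | x, w⟩ | ⟨p, w⟩
  · simp [starCount] at hq
  -- If `q` starts with `⋆`, the inserted word already uses up the breadth two, so `q` is `⋆`.
  · left
    rw [plug_consLetter_none] at h
    have hb := congrArg breadth h
    rw [breadth_mul] at hb
    simp only [breadth] at hb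
    obtain rfl := eq_one_of_plug_eq_one ht0 (breadth_eq_zero (u := plug t w) (by omega))
    exact fun s => mul_one s
  · simp [plug_consLetter_some] at h
  · right
    rw [plug_consBracket, consBracket.injEq] at h
    simp only [starCount] at hq
    rcases w with _ | ⟨_ | x, w⟩ | ⟨p', w⟩
    · simp [plug_one] at h
    -- After a first bracket only breadth one is left, too little for `t`.
    · have hb := congrArg breadth h.2
      rw [plug_consLetter_none, breadth_mul] at hb
      simp only [breadth] at hb
      omega
    · simp [plug_consLetter_some] at h
    · rw [plug_consBracket, consBracket.injEq] at h
      obtain rfl := eq_one_of_plug_eq_one ht0 h.2.2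
      obtain ⟨rfl, rfl, -⟩ := h
      simp only [starCount] at hq
      -- The only `⋆` lies in exactly one of the two brackets; the other is unaffected by
      -- substitution.
      rcases Nat.eq_zero_or_pos p.starCount with hp | hp
      · refine .inr ⟨⟨p', by omega⟩, rfl, fun s => ?_⟩
        rw [plug_eq_of_starCount_eq_zero hp t s]; rfl
      · refine .inl ⟨⟨p, by omega⟩, rfl, fun s => ?_⟩
        rw [plug_eq_of_starCount_eq_zero (show p'.starCount = 0 by omega) t s]; rfl

end StarWord

/-! ### The substitution set and the identities that resolve compositions -/

namespace OperatedPoly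

open BracketedWord

variable {k Z : Type*} [Field k]

theorem mono_mul (u v : BracketedWord Z) : mono k (u * v) = mono k u * mono k v :=
  map_mul (MonoidAlgebra.of k (BracketedWord Z)) u v

theorem op_mono (u : BracketedWord Z) : op k Z (mono k u) = mono k (bracket u) :=
  MonoidAlgebra.mapDomain_single

theorem eval_mono {X R : Type*} [Ring R] [Algebra k R] (P : R →ₗ[k] R) (r : X → R)
    (u : BracketedWord X) : eval P r (mono k u) = lift P r u := by
  simp [eval, mono]

/-- The element `φ(u, v)` of `k𝔐(Z)` for the modified Rota–Baxter identity `φ`. -/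
noncomputable def modifiedRotaBaxterAt (c : k) (u v : BracketedWord Z) : OperatedPoly k Z :=
  mono k (bracket u * bracket v) - mono k (bracket (u * bracket v))
    - mono k (bracket (bracket u * v)) - c • mono k (u * v)

theorem eval_modifiedRotaBaxter {X : Type*} (c : k) (x₁ x₂ : X) (r : X → BracketedWord Z) :
    eval (op k Z) (fun x => mono k (r x)) (modifiedRotaBaxter c x₁ x₂) =
      modifiedRotaBaxterAt c (r x₁) (r x₂) := by
  have key : ∀ u : BracketedWord X, eval (op k Z) (fun x => mono k (r x)) (mono k u) =
      lift (op k Z) (fun x => mono k (r x)) u := eval_mono _ _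
  simp only [modifiedRotaBaxter, var, op_mono, ← mono_mul, map_sub, map_smul, key]
  simp only [map_mul, modifiedRotaBaxterAt, mono_mul]
  have hl : ∀ x, lift (op k Z) (fun x => mono k (r x)) (letter x) = mono k (r x) :=
    fun x => mul_one _
  have hb : ∀ u : BracketedWord X, lift (op k Z) (fun x => mono k (r x)) (bracket u) =
      op k Z (lift (op k Z) (fun x => mono k (r x)) u) := fun u => mul_one _
  simp only [hb, map_mul, hl, op_mono, ← mono_mul]

theorem substitutionSet_modifiedRotaBaxter {X : Type*} (c : k) {x₁ x₂ : X} (hx : x₁ ≠ x₂) :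
    substitutionSet {modifiedRotaBaxter c x₁ x₂} Z =
      {f | ∃ u v : BracketedWord Z, f = modifiedRotaBaxterAt c u v} := by
  classical
  ext f
  constructor
  · rintro ⟨_, rfl, r, rfl⟩
    exact ⟨r x₁, r x₂, eval_modifiedRotaBaxter c x₁ x₂ r⟩
  · rintro ⟨u, v, rfl⟩
    refine ⟨_, rfl, fun x => if x = x₁ then u else v, ?_⟩
    rw [eval_modifiedRotaBaxter]
    simp [hx.symm]

theorem coeff_mono (u w : BracketedWord Z) [Decidable (u = w)] :
    (mono k u).coeff w = if u = w then 1 else 0 :=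
  Finsupp.single_apply

theorem leadMonomial_eq [LinearOrder (BracketedWord Z)] {f : OperatedPoly k Z}
    {w : BracketedWord Z} (hw : f.coeff w ≠ 0) (hf : ∀ m, w < m → f.coeff m = 0) :
    leadMonomial f = w := by
  have hmem : w ∈ f.coeff.support := Finsupp.mem_support_iff.2 hw
  rw [leadMonomial, dif_pos ⟨w, hmem⟩]
  refine le_antisymm (Finset.max'_le _ _ _ fun m hm => ?_) (Finset.le_max' _ _ hmem)
  by_contra! h
  exact Finsupp.mem_support_iff.1 hm (hf m h)

/-- Both ways of rewriting ⌊u⌋⌊v⌋⌊w⌋ are continued until they agree; the right side records the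
rewriting steps used. -/
theorem modifiedRotaBaxterAt_mul_sub (c : k) (u v w : BracketedWord Z) :
    modifiedRotaBaxterAt c u v * mono k (bracket w) -
        mono k (bracket u) * modifiedRotaBaxterAt c v w =
      modifiedRotaBaxterAt c u (v * bracket w) + modifiedRotaBaxterAt c u (bracket v * w)
        - modifiedRotaBaxterAt c (u * bracket v) w - modifiedRotaBaxterAt c (bracket u * v) w
        - ((StarWord.star Z).mulLeft u).bracketed.substPoly (modifiedRotaBaxterAt c v w)
        + ((StarWord.star Z).mulRight w).bracketed.substPoly (modifiedRotaBaxterAt c u v) := by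
  simp only [modifiedRotaBaxterAt, StarWord.substPoly_sub, StarWord.substPoly_smul,
    StarWord.substPoly_mono, StarWord.subst_bracketed, StarWord.subst_mulLeft,
    StarWord.subst_mulRight, StarWord.subst_star, sub_mul, mul_sub, smul_mul_assoc,
    mul_smul_comm, ← mono_mul, mul_assoc]
  module

/-- Put φ(a,b) = ⌊a⌋⌊b⌋ - r and expand φ(p|_{φ(a,b)}, v) by linearity in the first argument. The
terms in `p.subst` come from r, the `substPoly` terms from the three lower monomials of φ(·, v). -/
theorem modifiedRotaBaxterAt_sub_substPoly_left (c : k) (p q : StarWord Z)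
    (v a b : BracketedWord Z) (hq : ∀ s, q.subst s = bracket (p.subst s) * bracket v) :
    modifiedRotaBaxterAt c (p.subst (bracket a * bracket b)) v -
        q.substPoly (modifiedRotaBaxterAt c a b) =
      modifiedRotaBaxterAt c (p.subst (bracket (a * bracket b))) v
        + modifiedRotaBaxterAt c (p.subst (bracket (bracket a * b))) v
        + c • modifiedRotaBaxterAt c (p.subst (a * b)) v
        - (p.mulRight (bracket v)).bracketed.substPoly (modifiedRotaBaxterAt c a b)
        - (p.bracketed.mulRight v).bracketed.substPoly (modifiedRotaBaxterAt c a b)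
        - c • (p.mulRight v).substPoly (modifiedRotaBaxterAt c a b) := by
  simp only [modifiedRotaBaxterAt, StarWord.substPoly_sub, StarWord.substPoly_smul,
    StarWord.substPoly_mono, StarWord.subst_bracketed, StarWord.subst_mulRight, hq]
  module

theorem modifiedRotaBaxterAt_sub_substPoly_right (c : k) (p q : StarWord Z)
    (u a b : BracketedWord Z) (hq : ∀ s, q.subst s = bracket u * bracket (p.subst s)) :
    modifiedRotaBaxterAt c u (p.subst (bracket a * bracket b)) -
        q.substPoly (modifiedRotaBaxterAt c a b) =
      modifiedRotaBaxterAt c u (p.subst (bracket (a * bracket b)))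
        + modifiedRotaBaxterAt c u (p.subst (bracket (bracket a * b)))
        + c • modifiedRotaBaxterAt c u (p.subst (a * b))
        - (p.bracketed.mulLeft u).bracketed.substPoly (modifiedRotaBaxterAt c a b)
        - (p.mulLeft (bracket u)).bracketed.substPoly (modifiedRotaBaxterAt c a b)
        - c • (p.mulLeft u).substPoly (modifiedRotaBaxterAt c a b) := by
  simp only [modifiedRotaBaxterAt, StarWord.substPoly_sub, StarWord.substPoly_smul,
    StarWord.substPoly_mono, StarWord.subst_bracketed, StarWord.subst_mulLeft, hq]
  module

/-! ### Leading monomials and triviality of the compositions -/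

section Compositions

variable [LinearOrder Z]

attribute [local instance] BracketedWord.flatOrder

theorem coeff_modifiedRotaBaxterAt (c : k) (u v : BracketedWord Z) :
    (modifiedRotaBaxterAt c u v).coeff (bracket u * bracket v) = 1 := by
  simp [modifiedRotaBaxterAt, coeff_mono, (bracket_mul_bracket_right_lt u v).ne,
    (bracket_bracket_left_mul_lt u v).ne, (mul_lt_bracket_mul_bracket u v).ne]

theorem leadMonomial_modifiedRotaBaxterAt (c : k) (u v : BracketedWord Z) :
    leadMonomial (modifiedRotaBaxterAt c u v) = bracket u * bracket v := by
  refine leadMonomial_eq (by rw [coeff_modifiedRotaBaxterAt]; exact one_ne_zero) fun m hm => ?_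
  simp [modifiedRotaBaxterAt, coeff_mono, hm.ne,
    ((bracket_mul_bracket_right_lt u v).trans hm).ne,
    ((bracket_bracket_left_mul_lt u v).trans hm).ne,
    ((mul_lt_bracket_mul_bracket u v).trans hm).ne]

theorem monicize_modifiedRotaBaxterAt (c : k) (u v : BracketedWord Z) :
    monicize (modifiedRotaBaxterAt c u v) = modifiedRotaBaxterAt c u v := by
  rw [monicize, leadCoeff, leadMonomial_modifiedRotaBaxterAt, coeff_modifiedRotaBaxterAt, inv_one,
    one_smul]

theorem isTrivialMod_substPoly {c : k} {w : BracketedWord Z} (q : StarWord Z)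
    {a b : BracketedWord Z} (h : q.subst (bracket a * bracket b) < w) :
    IsTrivialMod {f | ∃ u v : BracketedWord Z, f = modifiedRotaBaxterAt c u v} w
      (q.substPoly (modifiedRotaBaxterAt c a b)) :=
  Submodule.subset_span
    ⟨q, _, ⟨a, b, rfl⟩, by rwa [leadMonomial_modifiedRotaBaxterAt], rfl⟩

theorem isTrivialMod_modifiedRotaBaxterAt {c : k} {w : BracketedWord Z}
    {a b : BracketedWord Z} (h : bracket a * bracket b < w) :
    IsTrivialMod {f | ∃ u v : BracketedWord Z, f = modifiedRotaBaxterAt c u v} w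
      (modifiedRotaBaxterAt c a b) := by
  have key := isTrivialMod_substPoly (c := c) (StarWord.star Z) (a := a) (b := b) (w := w)
    (by simpa using h)
  simpa [modifiedRotaBaxterAt, StarWord.substPoly_sub, StarWord.substPoly_smul] using key

theorem intersectionCompositionsTrivial [WellFoundedLT Z] (c : k) (u v a b : BracketedWord Z) :
    IntersectionCompositionsTrivial {f | ∃ u v : BracketedWord Z, f = modifiedRotaBaxterAt c u v}
      (modifiedRotaBaxterAt c u v) (modifiedRotaBaxterAt c a b) := by
  intro w x y hx hy h₁ h₂
  simp only [leadMonomial_modifiedRotaBaxterAt, breadth_mul, breadth_bracket] at hx hy h₁ h₂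
  have hbx := congrArg breadth hx
  have hby := congrArg breadth hy
  simp only [breadth_mul, breadth_bracket] at hbx hby
  have hxy := hx.symm.trans hy
  -- The bounds 2 < |w| < 4 force |w| = 3, so the overlap is exactly one bracket.
  obtain ⟨rfl, rfl, rfl⟩ : y = bracket u ∧ v = a ∧ x = bracket b := by
    rcases y with _ | ⟨_, y⟩ | ⟨y₁, y⟩
    · simp [breadth] at hby; omega
    · simp [consLetter_eq] at hxy
      cases hxy
    · simp only [breadth] at hby
      obtain rfl := breadth_eq_zero (u := y) (by omega)
      change consBracket u (consBracket v x) =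
        consBracket y₁ (consBracket a (consBracket b one)) at hxy
      simp only [consBracket.injEq] at hxy
      obtain ⟨rfl, rfl, rfl⟩ := hxy
      exact ⟨rfl, rfl, rfl⟩
  have mo := isMonomialOrder_flatOrder (Z := Z)
  have hl : ∀ {s t : BracketedWord Z} (p : BracketedWord Z), s < t → p * s < p * t :=
    fun {s t} p h => by simpa using mo.subst_lt_subst ((StarWord.star Z).mulLeft p) s t h
  have hr : ∀ {s t : BracketedWord Z} (p : BracketedWord Z), s < t → s * p < t * p :=
    fun {s t} p h => by simpa using mo.subst_lt_subst ((StarWord.star Z).mulRight p) s t h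
  rw [modifiedRotaBaxterAt_mul_sub]
  have l₁ := bracket_mul_bracket_right_lt v b
  have l₂ := bracket_bracket_left_mul_lt v b
  have r₁ := bracket_mul_bracket_right_lt u v
  have r₂ := bracket_bracket_left_mul_lt u v
  subst hx
  refine Submodule.add_mem _ (Submodule.sub_mem _ (Submodule.sub_mem _ (Submodule.sub_mem _
    (Submodule.add_mem _ ?_ ?_) ?_) ?_) ?_) ?_
  · exact isTrivialMod_modifiedRotaBaxterAt (by rw [mul_assoc]; exact hl _ l₁)
  · exact isTrivialMod_modifiedRotaBaxterAt (by rw [mul_assoc]; exact hl _ l₂)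
  · exact isTrivialMod_modifiedRotaBaxterAt (hr _ r₁)
  · exact isTrivialMod_modifiedRotaBaxterAt (hr _ r₂)
  · refine isTrivialMod_substPoly _ ?_
    simp only [StarWord.subst_bracketed, StarWord.subst_mulLeft, StarWord.subst_star, mul_assoc]
    -- ⌊u⌊v⌋⌊b⌋⌋ < ⌊u⌊v⌋⌋⌊b⌋ < ⌊u⌋⌊v⌋⌊b⌋.
    have := bracket_mul_bracket_right_lt (u * bracket v) b
    rw [mul_assoc] at this
    refine lt_trans this ?_
    rw [← mul_assoc (bracket u)]
    exact hr _ r₁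
  · refine isTrivialMod_substPoly _ ?_
    simp only [StarWord.subst_bracketed, StarWord.subst_mulRight, StarWord.subst_star, mul_assoc]
    -- ⌊⌊u⌋⌊v⌋b⌋ < ⌊u⌋⌊⌊v⌋b⌋ < ⌊u⌋⌊v⌋⌊b⌋.
    exact lt_trans (bracket_bracket_left_mul_lt u (bracket v * b)) (hl _ l₂)

theorem includingCompositionsTrivial [WellFoundedLT Z] (c : k) (u v a b : BracketedWord Z) :
    IncludingCompositionsTrivial {f | ∃ u v : BracketedWord Z, f = modifiedRotaBaxterAt c u v}
      (modifiedRotaBaxterAt c u v) (modifiedRotaBaxterAt c a b) := by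
  intro w q hw hq
  simp only [leadMonomial_modifiedRotaBaxterAt] at hw hq
  subst hw
  have mo := isMonomialOrder_flatOrder (Z := Z)
  have l₁ := bracket_mul_bracket_right_lt a b
  have l₂ := bracket_bracket_left_mul_lt a b
  have l₃ := mul_lt_bracket_mul_bracket a b
  rcases StarWord.subst_eq_bracket_mul_bracket
    (by simp [breadth_mul, breadth_bracket]) hq.symm with h | ⟨p, rfl, h⟩ | ⟨p, rfl, h⟩
  · rw [h, bracket_mul_bracket, bracket_mul_bracket] at hq
    simp only [consBracket.injEq, and_true] at hq
    obtain ⟨rfl, rfl⟩ := hq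
    have : q.substPoly (modifiedRotaBaxterAt c u v) = modifiedRotaBaxterAt c u v := by
      simp [modifiedRotaBaxterAt, StarWord.substPoly_sub, StarWord.substPoly_smul, h]
    rw [this, sub_self]
    exact Submodule.zero_mem _
  · rw [modifiedRotaBaxterAt_sub_substPoly_left c p q v a b h]
    have hp : ∀ s t : BracketedWord Z, s < t →
        bracket (p.subst s) * bracket v < bracket (p.subst t) * bracket v := fun s t hst => by
      simpa using mo.subst_lt_subst (p.bracketed.mulRight (bracket v)) s t hst
    refine Submodule.sub_mem _ (Submodule.sub_mem _ (Submodule.sub_mem _ (Submodule.add_mem _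
      (Submodule.add_mem _ ?_ ?_) (Submodule.smul_mem _ _ ?_)) ?_) ?_) (Submodule.smul_mem _ _ ?_)
    · exact isTrivialMod_modifiedRotaBaxterAt (hp _ _ l₁)
    · exact isTrivialMod_modifiedRotaBaxterAt (hp _ _ l₂)
    · exact isTrivialMod_modifiedRotaBaxterAt (hp _ _ l₃)
    -- With ⌊a⌋⌊b⌋ inserted, the remaining three words are the lower monomials of φ(p|_{⌊a⌋⌊b⌋}, v)
    -- itself.
    · exact isTrivialMod_substPoly _ (by simpa using bracket_mul_bracket_right_lt _ v)
    · exact isTrivialMod_substPoly _ (by simpa using bracket_bracket_left_mul_lt _ v)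
    · exact isTrivialMod_substPoly _ (by simpa using mul_lt_bracket_mul_bracket _ v)
  · rw [modifiedRotaBaxterAt_sub_substPoly_right c p q u a b h]
    have hp : ∀ s t : BracketedWord Z, s < t →
        bracket u * bracket (p.subst s) < bracket u * bracket (p.subst t) := fun s t hst => by
      simpa using mo.subst_lt_subst (p.bracketed.mulLeft (bracket u)) s t hst
    refine Submodule.sub_mem _ (Submodule.sub_mem _ (Submodule.sub_mem _ (Submodule.add_mem _
      (Submodule.add_mem _ ?_ ?_) (Submodule.smul_mem _ _ ?_)) ?_) ?_) (Submodule.smul_mem _ _ ?_)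
    · exact isTrivialMod_modifiedRotaBaxterAt (hp _ _ l₁)
    · exact isTrivialMod_modifiedRotaBaxterAt (hp _ _ l₂)
    · exact isTrivialMod_modifiedRotaBaxterAt (hp _ _ l₃)
    · exact isTrivialMod_substPoly _ (by simpa using bracket_mul_bracket_right_lt u _)
    · exact isTrivialMod_substPoly _ (by simpa using bracket_bracket_left_mul_lt u _)
    · exact isTrivialMod_substPoly _ (by simpa using mul_lt_bracket_mul_bracket u _)

theorem isGroebnerShirshovBasis_modifiedRotaBaxter [WellFoundedLT Z] (c : k) :
    IsGroebnerShirshovBasis {f | ∃ u v : BracketedWord Z, f = modifiedRotaBaxterAt c u v} := by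
  rintro _ ⟨u, v, rfl⟩ _ ⟨a, b, rfl⟩ - -
  rw [monicize_modifiedRotaBaxterAt, monicize_modifiedRotaBaxterAt]
  exact ⟨intersectionCompositionsTrivial c u v a b, includingCompositionsTrivial c u v a b⟩

end Compositions

end OperatedPoly

theorem mainTheorem4 {k : Type u} [Field k] {X : Type v} (x₁ x₂ : X) (hx : x₁ ≠ x₂)
    (c : k) :
    OperatedPoly.IsGroebnerShirshov.{w}
      ({OperatedPoly.modifiedRotaBaxter c x₁ x₂} : Set (OperatedPoly k X)) := by
  intro Z
  -- The set Z carries no order; any well-order of it serves.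
  obtain ⟨_, _⟩ := exists_wellFoundedLT Z
  refine ⟨BracketedWord.flatOrder Z, BracketedWord.isMonomialOrder_flatOrder, ?_⟩
  rw [OperatedPoly.substitutionSet_modifiedRotaBaxter c hx]
  exact OperatedPoly.isGroebnerShirshovBasis_modifiedRotaBaxter c
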